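/- Let $(\varepsilon_n)$ be a sequence of positive numbers with $\varepsilon_n\to 0$. Then there exist a sequence $\Lambda=\{\lambda_n\}$ of positive real numbers with $$\frac{\lambda_{n+1}}{\lambda_n}>1+\varepsilon_n\quad\text{for all } n,$$ which is uniformly discrete, i.e. $\inf_{n\ne m}|\lambda_n-\lambda_m|>0$, and a function $g\in L^2(\mathbb R)$ (complex valued), such that the system of translates $u_n(t)=g(t-\lambda_n)$ is a (QF)-system in $L^2(\mathbb R)$, that is: (i) for every real $q>2$ there is a constant $C(q)$ such that for all $f\in L^2(\mathbb R)$ and $\epsilon>0$ there is a finite linear combination $Q=\sum_n c_nu_n$ with complex coefficients satisfying $\|f-Q\|<\epsilon$ and $\|\{c_n\}\|_{\ell_q}\le C(q)\|f\|$; (ii) (Bessel inequality) there is a constant $C'$ such that $\left(\sum_n|\langle f,u_n\rangle|^2\right)^{1/2}\le C'\|f\|$ for all $f\in L^2(\mathbb R)$. -/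

import Mathlib

open MeasureTheory Filter Topology

/-- A set of reals is uniformly discrete if distinct points are at distance at least some
fixed `δ > 0`. -/
def UniformlyDiscrete (S : Set ℝ) : Prop :=
  ∃ δ : ℝ, 0 < δ ∧ S.Pairwise fun x y => δ ≤ |x - y|

/-- The complex Hilbert space `L²(ℝ)` for Lebesgue measure. -/
abbrev L2R : Type := Lp ℂ 2 (volume : Measure ℝ)

/-- The translate `t ↦ g (t - a)` of `g ∈ L²(ℝ)`. -/
noncomputable def translateL2 (g : L2R) (a : ℝ) : L2R :=
  Lp.compMeasurePreserving (fun t : ℝ => t - a) (measurePreserving_sub_right volume a) g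

theorem coeFn_translateL2 (g : L2R) (a : ℝ) : translateL2 g a =ᵐ[volume] fun t => g (t - a) :=
  Lp.coeFn_compMeasurePreserving g (measurePreserving_sub_right volume a)

section QF

variable {ι H : Type*} [NormedAddCommGroup H] [InnerProductSpace ℂ H]

/-- The `ℓ_q` norm of a finitely supported family of complex numbers. -/
noncomputable def lqNorm (q : ℝ) (c : ι →₀ ℂ) : ℝ :=
  (c.sum fun _ z => ‖z‖ ^ q) ^ (1 / q)

/-- Completeness with `ℓ_q` estimate of coefficients, for the exponent `q`. -/
def CompleteWithLqEstimate (q : ℝ) (u : ι → H) : Prop :=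
  ∃ C : ℝ, ∀ f : H, ∀ ε : ℝ, 0 < ε →
    ∃ c : ι →₀ ℂ, ‖f - c.sum (fun n z => z • u n)‖ < ε ∧ lqNorm q c ≤ C * ‖f‖

/-- Bessel inequality (the convergence of the sum is part of the claim). -/
def IsBessel (u : ι → H) : Prop :=
  ∃ C : ℝ, ∀ f : H,
    Summable (fun n => ‖inner ℂ f (u n)‖ ^ 2) ∧
      Real.sqrt (∑' n, ‖inner ℂ f (u n)‖ ^ 2) ≤ C * ‖f‖

/-- `(QF)`-systems ("quasi-frames"). -/
def IsQF (u : ι → H) : Prop :=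
  (∀ q : ℝ, 2 < q → CompleteWithLqEstimate q u) ∧ IsBessel u

end QF

/-!
For every `q > 2` and `η > 0` there is a trigonometric polynomial `P` with only positive
frequencies, with coefficients of `ℓ_q` norm at most `η`, and with `P` close to `1` off a small set.
Without the positivity of the frequencies, one removes the constant term from the Fourier series of
a unit mass spread over a short arc and averages over `r` lacunary dilates, which multiplies the
`ℓ_q` norm by `r ^ (1 / q - 1)` and the exceptional measure by at most `r`. The negative frequencies
are then moved to the right by multiplying with a polynomial in `e(n x)`, without constant term,
which is itself close to `1` in measure: take `1 - exp (s z / (1 - z))`, whose distance from `1` on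
the unit circle is the constant `exp (-s / 2)`.

Take such polynomials `P_k` with `q_k → 2` and errors `2⁻ᵏ`. Dilations preserve the measure of the
exceptional sets, so by Borel-Cantelli there is a bounded nonvanishing weight `m` for which all
`m (P_k (D_k x) - 1)` are uniformly small, where the dilations `D_k` may grow arbitrarily fast.
Let `g` be the inverse Fourier transform of `m` times the transform of `1_{[0, 1)}`. On the Fourier
side, `g (· - ν_k)` is then well approximated by the combination with coefficients those of `P_k` of
the translates of `g` along the progression `ν_k + D_k j`, `j = 1, 2, …`. The relative gaps of this
progression are of order `1 / j`, so placing it late enough in the sequence beats `ε_n`. Letting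
each `ν` of a dense set occur infinitely often, such translates span a dense subspace. The Bessel
inequality holds because unit-separated translates of `1_{[0, 1)}` are orthonormal and `g`
arises from it by a bounded operator commuting with translations.
-/

open scoped ENNReal Polynomial

section LqNorm

variable {ι κ H : Type*} {q : ℝ}

theorem lqNorm_eq_sum_rpow {s : Finset ι} {c : ι →₀ ℂ} (hq : q ≠ 0) (hs : c.support ⊆ s) :
    lqNorm q c = (∑ i ∈ s, ‖c i‖ ^ q) ^ (1 / q) := by
  rw [lqNorm, Finsupp.sum_of_support_subset c hs _ fun _ _ => by simp [hq]]

theorem lqNorm_nonneg (q : ℝ) (c : ι →₀ ℂ) : 0 ≤ lqNorm q c :=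
  Real.rpow_nonneg (Finset.sum_nonneg fun _ _ => by positivity) _

theorem lqNorm_rpow {s : Finset ι} {c : ι →₀ ℂ} (hq : q ≠ 0) (hs : c.support ⊆ s) :
    lqNorm q c ^ q = ∑ i ∈ s, ‖c i‖ ^ q := by
  rw [lqNorm_eq_sum_rpow hq hs, ← Real.rpow_mul (Finset.sum_nonneg fun _ _ => by positivity),
    one_div_mul_cancel hq, Real.rpow_one]

theorem lqNorm_zero (hq : q ≠ 0) : lqNorm q (0 : ι →₀ ℂ) = 0 := by
  simp [lqNorm, hq]

theorem lqNorm_add_le (hq : 1 ≤ q) (c d : ι →₀ ℂ) :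
    lqNorm q (c + d) ≤ lqNorm q c + lqNorm q d := by
  classical
  have hq0 : q ≠ 0 := by positivity
  rw [lqNorm_eq_sum_rpow hq0 Finsupp.support_add,
    lqNorm_eq_sum_rpow (c := c) hq0 (Finset.subset_union_left (s₂ := d.support)),
    lqNorm_eq_sum_rpow (c := d) hq0 (Finset.subset_union_right (s₁ := c.support))]
  have h := Real.Lp_add_le (c.support ∪ d.support) (fun i => ‖c i‖) (fun i => ‖d i‖) hq
  simp only [abs_of_nonneg, norm_nonneg, add_nonneg] at h
  refine le_trans ?_ h
  gcongr with i
  exact norm_add_le (c i) (d i)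

theorem lqNorm_smul (hq : q ≠ 0) (z : ℂ) (c : ι →₀ ℂ) :
    lqNorm q (z • c) = ‖z‖ * lqNorm q c := by
  rw [lqNorm_eq_sum_rpow hq Finsupp.support_smul, lqNorm, Finsupp.sum]
  simp only [Finsupp.smul_apply, norm_smul, Real.mul_rpow (norm_nonneg _) (norm_nonneg _),
    ← Finset.mul_sum]
  rw [Real.mul_rpow (by positivity) (by positivity), ← Real.rpow_mul (norm_nonneg z),
    mul_one_div_cancel hq, Real.rpow_one]

theorem lqNorm_sum_le (hq : 1 ≤ q) (s : Finset κ) (c : κ → ι →₀ ℂ) :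
    lqNorm q (∑ k ∈ s, c k) ≤ ∑ k ∈ s, lqNorm q (c k) :=
  Finset.le_sum_of_subadditive _ (lqNorm_zero (by positivity)).le (lqNorm_add_le hq) _ _

theorem lqNorm_sum_rpow_of_disjoint (hq : q ≠ 0) {s : Finset κ} {c : κ → ι →₀ ℂ}
    (hc : Pairwise fun k l => Disjoint (c k).support (c l).support) :
    lqNorm q (∑ k ∈ s, c k) ^ q = ∑ k ∈ s, lqNorm q (c k) ^ q := by
  classical
  simp only [lqNorm_rpow hq subset_rfl]
  rw [Finsupp.support_sum_eq_biUnion s hc, Finset.sum_biUnion fun k _ l _ hkl => hc hkl]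
  refine Finset.sum_congr rfl fun k hk => Finset.sum_congr rfl fun i hi => ?_
  rw [Finsupp.finsetSum_apply, Finset.sum_eq_single_of_mem k hk fun l _ hl => ?_]
  exact Finsupp.notMem_support_iff.mp (Finset.disjoint_left.mp (hc hl.symm) hi)

theorem lqNorm_mapDomain {f : ι → κ} (hf : f.Injective) (c : ι →₀ ℂ) :
    lqNorm q (c.mapDomain f) = lqNorm q c := by
  rw [lqNorm, Finsupp.sum_mapDomain_index_inj hf, lqNorm]

theorem norm_apply_le_lqNorm (hq : 0 < q) (c : ι →₀ ℂ) (i : ι) : ‖c i‖ ≤ lqNorm q c := by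
  by_cases hi : i ∈ c.support
  · rw [← Real.rpow_le_rpow_iff (norm_nonneg _) (lqNorm_nonneg q c) hq,
      lqNorm_rpow hq.ne' subset_rfl]
    exact Finset.single_le_sum (f := fun i => ‖c i‖ ^ q) (fun _ _ => by positivity) hi
  · rw [Finsupp.notMem_support_iff.mp hi, norm_zero]
    exact lqNorm_nonneg q c

theorem lqNorm_anti {p : ℝ} (hp : 0 < p) (hpq : p ≤ q) (c : ι →₀ ℂ) : lqNorm q c ≤ lqNorm p c := by
  have hq : 0 < q := hp.trans_le hpq
  have hL := lqNorm_nonneg p c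
  rw [← Real.rpow_le_rpow_iff (lqNorm_nonneg q c) hL hq, lqNorm_rpow hq.ne' subset_rfl]
  calc ∑ i ∈ c.support, ‖c i‖ ^ q
      ≤ ∑ i ∈ c.support, ‖c i‖ ^ p * lqNorm p c ^ (q - p) := by
        refine Finset.sum_le_sum fun i _ => ?_
        rw [← add_sub_cancel p q, Real.rpow_add_of_nonneg (norm_nonneg _) hp.le (by linarith),
          add_sub_cancel p q]
        gcongr
        exact norm_apply_le_lqNorm hp c i
    _ = lqNorm p c ^ q := by
        rw [← Finset.sum_mul, ← lqNorm_rpow hp.ne' subset_rfl,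
          ← Real.rpow_add_of_nonneg hL hp.le (by linarith), add_sub_cancel]

variable [NormedAddCommGroup H] [InnerProductSpace ℂ H]

/-- The subspace of vectors approximable by linear combinations of `u` whose coefficients have
arbitrarily small `ℓ_q` norm. -/
def vanishingLqSpan (hq : 1 ≤ q) (u : ι → H) : Submodule ℂ H where
  carrier := {v | ∀ η : ℝ, 0 < η → ∃ c : ι →₀ ℂ,
    ‖v - Finsupp.linearCombination ℂ u c‖ < η ∧ lqNorm q c < η}
  zero_mem' η hη := ⟨0, by simpa, by rwa [lqNorm_zero (by positivity)]⟩
  add_mem' {v w} hv hw η hη := by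
    obtain ⟨c, hc, hcq⟩ := hv (η / 2) (by positivity)
    obtain ⟨d, hd, hdq⟩ := hw (η / 2) (by positivity)
    refine ⟨c + d, ?_, (lqNorm_add_le hq c d).trans_lt (by linarith)⟩
    rw [map_add, add_sub_add_comm]
    exact (norm_add_le _ _).trans_lt (by linarith)
  smul_mem' z v hv η hη := by
    obtain ⟨c, hc, hcq⟩ := hv (η / (‖z‖ + 1)) (by positivity)
    rw [lt_div_iff₀' (by positivity)] at hc hcq
    have := norm_nonneg (v - Finsupp.linearCombination ℂ u c)
    have := lqNorm_nonneg q c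
    refine ⟨z • c, ?_, ?_⟩
    · rw [map_smul, ← smul_sub, norm_smul]
      linarith
    · rw [lqNorm_smul (by positivity)]
      linarith

theorem completeWithLqEstimate_of_span_dense (hq : 1 ≤ q) {u : ι → H} {V : Set H}
    (hV : (Submodule.span ℂ V).topologicalClosure = ⊤) (h : V ⊆ vanishingLqSpan hq u) :
    CompleteWithLqEstimate q u := by
  have hspan : Dense (Submodule.span ℂ V : Set H) :=
    Submodule.dense_iff_topologicalClosure_eq_top.mpr hV
  refine ⟨1, fun f ε hε => ?_⟩
  rcases eq_or_ne f 0 with rfl | hf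
  · exact ⟨0, by simpa using hε, by simp [lqNorm_zero (ne_of_gt (one_pos.trans_le hq))]⟩
  obtain ⟨w, hw, hfw⟩ := hspan.exists_dist_lt f (half_pos hε)
  obtain ⟨c, hc, hcq⟩ := Submodule.span_le.mpr h hw (min (ε / 2) ‖f‖) (by positivity)
  refine ⟨c, ?_, by linarith [min_le_right (ε / 2) ‖f‖]⟩
  rw [dist_eq_norm] at hfw
  calc ‖f - Finsupp.linearCombination ℂ u c‖
      ≤ ‖f - w‖ + ‖w - Finsupp.linearCombination ℂ u c‖ := norm_sub_le_norm_sub_add_norm_sub ..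
    _ < ε := by linarith [min_le_left (ε / 2) ‖f‖]

theorem isBessel_of_orthonormal [CompleteSpace H] {v : ι → H} (hv : Orthonormal ℂ v)
    (A : H →L[ℂ] H) : IsBessel fun i => A (v i) := by
  refine ⟨‖A‖, fun f => ?_⟩
  have hinner (i : ι) : ‖inner ℂ f (A (v i))‖ = ‖inner ℂ (v i) (A.adjoint f)‖ := by
    rw [← A.adjoint_inner_left, norm_inner_symm]
  simp only [hinner]
  refine ⟨hv.inner_products_summable _, Real.sqrt_le_iff.mpr ⟨by positivity, ?_⟩⟩
  calc ∑' i, ‖inner ℂ (v i) (A.adjoint f)‖ ^ 2 ≤ ‖A.adjoint f‖ ^ 2 := hv.tsum_inner_products_le _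
    _ ≤ (‖A‖ * ‖f‖) ^ 2 := by
      gcongr
      simpa using A.adjoint.le_opNorm f

end LqNorm

section NearOne

variable {α β ι : Type*} [MeasurableSpace α] {μ : Measure α} {η η' : ℝ} {δ δ' : ℝ≥0∞}
  {f g : α → ℂ}

/-- `f` is within `η` of the constant `1` outside a set of `μ`-measure at most `δ`. -/
def NearOneInMeasure (μ : Measure α) (η : ℝ) (δ : ℝ≥0∞) (f : α → ℂ) : Prop :=
  μ {x | η < ‖f x - 1‖} ≤ δ

theorem NearOneInMeasure.mono (hf : NearOneInMeasure μ η δ f) (hη : η ≤ η') (hδ : δ ≤ δ') :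
    NearOneInMeasure μ η' δ' f :=
  (measure_mono fun _ hx => hη.trans_lt hx).trans (hf.trans hδ)

theorem NearOneInMeasure.comp_measurePreserving [MeasurableSpace β] {ν : Measure β} {φ : β → α}
    (hf : NearOneInMeasure μ η δ f) (hfm : Measurable f) (hφ : MeasurePreserving φ ν μ) :
    NearOneInMeasure ν η δ fun y => f (φ y) := by
  have hs : MeasurableSet {x | η < ‖f x - 1‖} :=
    measurableSet_lt measurable_const (hfm.sub_const 1).norm
  exact (hφ.measure_preimage hs.nullMeasurableSet).trans_le hf

theorem NearOneInMeasure.mul (hf : NearOneInMeasure μ η δ f) (hg : NearOneInMeasure μ η δ' g)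
    (hη : η ≤ 1) : NearOneInMeasure μ (3 * η) (δ + δ') fun x => f x * g x := by
  refine (measure_mono fun x hx => ?_).trans ((measure_union_le _ _).trans (add_le_add hf hg))
  by_contra! hfg
  simp only [Set.mem_union, Set.mem_ofPred_eq, not_or, not_lt] at hx hfg
  refine hx.not_ge ?_
  calc ‖f x * g x - 1‖ = ‖(f x - 1) * (g x - 1) + (f x - 1) + (g x - 1)‖ := by ring_nf
    _ ≤ ‖f x - 1‖ * ‖g x - 1‖ + ‖f x - 1‖ + ‖g x - 1‖ := by
      simpa only [norm_mul] using norm_add₃_le (a := (f x - 1) * (g x - 1))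
    _ ≤ 1 * η + η + η := by gcongr <;> linarith
    _ = 3 * η := by ring

theorem NearOneInMeasure.average {s : Finset ι} (hs : s.Nonempty) {f : ι → α → ℂ}
    (hf : ∀ i ∈ s, NearOneInMeasure μ η δ (f i)) :
    NearOneInMeasure μ η (s.card * δ) fun x => (s.card : ℂ)⁻¹ * ∑ i ∈ s, f i x := by
  have hcard : (s.card : ℂ) ≠ 0 := by simpa using hs.ne_empty
  have hbad :
      {x | η < ‖(s.card : ℂ)⁻¹ * ∑ i ∈ s, f i x - 1‖} ⊆ ⋃ i ∈ s, {x | η < ‖f i x - 1‖} := by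
    intro x hx
    by_contra! hgood
    simp only [Set.mem_iUnion, Set.mem_ofPred_eq, not_exists, not_lt] at hx hgood
    refine hx.not_ge ?_
    calc ‖(s.card : ℂ)⁻¹ * ∑ i ∈ s, f i x - 1‖ = (s.card : ℝ)⁻¹ * ‖∑ i ∈ s, (f i x - 1)‖ := by
          rw [← Complex.norm_natCast, ← norm_inv, ← norm_mul, Finset.sum_sub_distrib, mul_sub]
          simp [hcard]
      _ ≤ (s.card : ℝ)⁻¹ * (s.card • η) := by
          gcongr
          exact (norm_sum_le_of_le _ hgood).trans_eq (by simp)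
      _ = η := by
          rw [nsmul_eq_mul, inv_mul_cancel_left₀ (by exact_mod_cast hcard)]
  calc _ ≤ _ := measure_mono hbad
    _ ≤ _ := measure_biUnion_finset_le s _
    _ ≤ s.card • δ := Finset.sum_le_card_nsmul _ _ _ hf
    _ = s.card * δ := nsmul_eq_mul _ _

end NearOne

section TrigPoly

/-- The trigonometric polynomial `∑ c_j e(j x)` on the circle. -/
noncomputable def trigPoly : (ℤ →₀ ℂ) →ₗ[ℂ] C(UnitAddCircle, ℂ) :=
  Finsupp.linearCombination ℂ fourier

theorem trigPoly_apply (c : ℤ →₀ ℂ) (x : UnitAddCircle) :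
    trigPoly c x = c.sum fun j z => z * fourier j x := by
  simp [trigPoly, Finsupp.linearCombination_apply, Finsupp.sum, ContinuousMap.sum_apply]

theorem trigPoly_indicator (s : Finset ℤ) (a : ℤ → ℂ) (x : UnitAddCircle) :
    trigPoly (Finsupp.indicator s fun j _ => a j) x = ∑ j ∈ s, a j * fourier j x := by
  rw [trigPoly_apply, Finsupp.sum_indicator_index _ fun _ _ => zero_mul _]

theorem trigPoly_mapDomain_mul (n : ℤ) (c : ℤ →₀ ℂ) (x : UnitAddCircle) :
    trigPoly (c.mapDomain (n * ·)) x = trigPoly c (n • x) := by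
  rw [trigPoly_apply, trigPoly_apply, Finsupp.sum_mapDomain_index (by simp) (by simp [add_mul])]
  simp only [fourier_apply, smul_smul, mul_comm]

theorem trigPoly_mapDomain_add (n : ℤ) (c : ℤ →₀ ℂ) (x : UnitAddCircle) :
    trigPoly (c.mapDomain (n + ·)) x = fourier n x * trigPoly c x := by
  rw [trigPoly_apply, trigPoly_apply, Finsupp.sum_mapDomain_index (by simp) (by simp [add_mul]),
    Finsupp.mul_sum]
  simp only [fourier_add, mul_left_comm]

theorem norm_fourier_apply (n : ℤ) (x : UnitAddCircle) : ‖(fourier n x : ℂ)‖ = 1 := by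
  rw [fourier_apply, Circle.norm_coe]

theorem NearOneInMeasure.trigPoly_dilate {η : ℝ} {δ : ℝ≥0∞} {c : ℤ →₀ ℂ}
    (hc : NearOneInMeasure volume η δ (trigPoly c)) {n : ℤ} (hn : n ≠ 0) :
    NearOneInMeasure volume η δ (trigPoly (c.mapDomain (n * ·))) := by
  simp only [NearOneInMeasure, trigPoly_mapDomain_mul]
  exact hc.comp_measurePreserving (trigPoly c).continuous.measurable
    (Measure.measurePreserving_zsmul volume hn)

end TrigPoly

section AnalyticPolynomial

open Polynomial

theorem re_div_one_sub {z : ℂ} (hz : ‖z‖ = 1) (h1 : z ≠ 1) : (z / (1 - z)).re = -1 / 2 := by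
  have hz2 : z.re ^ 2 + z.im ^ 2 = 1 := by
    rw [← Complex.normSq_add_mul_I, Complex.re_add_im, Complex.normSq_eq_norm_sq, hz, one_pow]
  have hn : Complex.normSq (1 - z) = 2 * (1 - z.re) := by
    simp only [Complex.normSq_apply, Complex.sub_re, Complex.sub_im, Complex.one_re, Complex.one_im]
    linear_combination hz2
  have hne : Complex.normSq (1 - z) ≠ 0 := by
    simpa [Complex.normSq_eq_zero, sub_eq_zero] using h1.symm
  rw [Complex.div_re, ← add_div, div_eq_iff hne, hn]
  simp only [Complex.sub_re, Complex.sub_im, Complex.one_re, Complex.one_im]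
  linear_combination -hz2

/-- The `k`-th Cesàro mean of the partial sums of `∑ X ^ (j + 1)`. Unlike the partial sums
themselves, these converge to `z / (1 - z)` on the unit circle away from `1`. -/
noncomputable def cesaroGeom (k : ℕ) : ℂ[X] :=
  C (k : ℂ)⁻¹ * ∑ n ∈ Finset.range k, ∑ j ∈ Finset.range n, X ^ (j + 1)

theorem eval_cesaroGeom {z : ℂ} (hz : z ≠ 1) {k : ℕ} (hk : k ≠ 0) :
    (cesaroGeom k).eval z = z / (1 - z) + (k : ℂ)⁻¹ * (z * (z ^ k - 1) / (z - 1) ^ 2) := by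
  have h1 : z - 1 ≠ 0 := sub_ne_zero.mpr hz
  have h2 : 1 - z ≠ 0 := sub_ne_zero.mpr hz.symm
  simp only [cesaroGeom, eval_mul, eval_C, eval_finsetSum, eval_pow, eval_X, pow_succ,
    ← Finset.sum_mul, geom_sum_eq hz, ← Finset.sum_div, Finset.sum_sub_distrib,
    Finset.sum_const, Finset.card_range, nsmul_eq_mul, mul_one]
  field_simp
  ring

theorem tendsto_eval_cesaroGeom {z : ℂ} (hz : ‖z‖ ≤ 1) (h1 : z ≠ 1) :
    Tendsto (fun k => (cesaroGeom k).eval z) atTop (𝓝 (z / (1 - z))) := by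
  have hbdd : IsBoundedUnder (· ≤ ·) atTop
      fun k : ℕ => ‖z * (z ^ k - 1) / (z - 1) ^ 2‖ := by
    refine isBoundedUnder_of ⟨1 * (1 + 1) / ‖z - 1‖ ^ 2, fun k => ?_⟩
    rw [norm_div, norm_mul, norm_pow]
    gcongr
    refine (norm_sub_le _ _).trans ?_
    rw [norm_pow, norm_one]
    gcongr
    exact pow_le_one₀ (norm_nonneg z) hz
  have h0 := (tendsto_inv_atTop_nhds_zero_nat (𝕜 := ℂ)).zero_mul_isBoundedUnder_le hbdd
  rw [← add_zero (z / (1 - z))]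
  refine (tendsto_const_nhds.add h0).congr' ?_
  filter_upwards [eventually_ne_atTop 0] with k hk
  rw [eval_cesaroGeom h1 hk]

/-- Polynomials approximating `exp (s z / (1 - z))` on the unit circle. -/
noncomputable def approxExp (s : ℂ) (k : ℕ) : ℂ[X] :=
  (1 + C (s / k) * cesaroGeom k) ^ k

theorem coeff_zero_approxExp (s : ℂ) (k : ℕ) : (approxExp s k).coeff 0 = 1 := by
  simp [coeff_zero_eq_eval_zero, approxExp, cesaroGeom, eval_finsetSum]

theorem tendsto_eval_approxExp (s : ℂ) {z : ℂ} (hz : ‖z‖ ≤ 1) (h1 : z ≠ 1) :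
    Tendsto (fun k => (approxExp s k).eval z) atTop (𝓝 (Complex.exp (s * (z / (1 - z))))) := by
  simp only [approxExp, eval_pow, eval_add, eval_one, eval_mul, eval_C]
  refine Complex.tendsto_one_add_pow_exp_of_tendsto
    (((tendsto_eval_cesaroGeom hz h1).const_mul s).congr' ?_)
  filter_upwards [eventually_ne_atTop 0] with k hk
  field_simp

theorem fourier_one_ne_one {x : UnitAddCircle} (hx : x ≠ 0) : (fourier 1 x : ℂ) ≠ 1 := by
  rw [fourier_one, ← Circle.coe_one, Ne, Circle.coe_inj, ← AddCircle.toCircle_zero]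
  exact (AddCircle.injective_toCircle one_ne_zero).ne hx

theorem exists_polynomial_nearOne {η : ℝ} {δ : ℝ≥0∞} (hη : 0 < η) (hδ : δ ≠ 0) :
    ∃ p : ℂ[X], p.coeff 0 = 0 ∧
      NearOneInMeasure volume η δ fun x : UnitAddCircle => p.eval (fourier 1 x) := by
  obtain ⟨s, hs⟩ : ∃ s : ℝ, Real.exp (s * (-1 / 2)) < η / 2 := by
    have hlim : Tendsto (fun s : ℝ => Real.exp (s * (-1 / 2))) atTop (𝓝 0) :=
      Real.tendsto_exp_atBot.comp (tendsto_id.atTop_mul_const_of_neg (by norm_num))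
    exact (hlim.eventually_lt_const (half_pos hη)).exists
  have hne : ∀ᵐ x : UnitAddCircle, x ≠ 0 := by
    rw [ae_iff]
    simpa using AddCircle.volume_closedBall (1 : ℝ) (x := 0) 0
  set F : UnitAddCircle → ℂ := fun x => Complex.exp (s * (fourier 1 x / (1 - fourier 1 x)))
  have hF : ∀ᵐ x, ‖F x‖ < η / 2 := by
    filter_upwards [hne] with x hx
    rwa [Complex.norm_exp, Complex.re_ofReal_mul,
      re_div_one_sub (norm_fourier_apply 1 x) (fourier_one_ne_one hx)]
  have hlim : TendstoInMeasure volume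
      (fun k (x : UnitAddCircle) => (approxExp s k).eval (fourier 1 x)) atTop F := by
    refine tendstoInMeasure_of_tendsto_ae
      (fun k => Continuous.aestronglyMeasurable (by fun_prop)) ?_
    filter_upwards [hne] with x hx
    exact tendsto_eval_approxExp s (norm_fourier_apply 1 x).le (fourier_one_ne_one hx)
  obtain ⟨k, hk⟩ := ((hlim (ENNReal.ofReal (η / 2)) (by simpa)).eventually_le_const
    (pos_iff_ne_zero.mpr hδ)).exists
  refine ⟨1 - approxExp s k, by simp [coeff_zero_approxExp], (measure_mono_ae ?_).trans hk⟩
  filter_upwards [hF] with x hFx (hx : η < ‖(1 - approxExp s k).eval (fourier 1 x) - 1‖)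
  change ENNReal.ofReal (η / 2) ≤ edist _ _
  simp only [eval_sub, eval_one, sub_sub_cancel_left, norm_neg] at hx
  rw [edist_dist, dist_eq_norm]
  gcongr
  linarith [norm_sub_norm_le (eval (fourier 1 x) (approxExp s k)) (F x)]

end AnalyticPolynomial

section Concentrated

open AddCircle

theorem haarAddCircle_one_eq_volume : (haarAddCircle : Measure UnitAddCircle) = volume := by
  rw [volume_eq_smul_haarAddCircle, ENNReal.ofReal_one, one_smul]

variable {T : ℝ} [Fact (0 < T)] {f : AddCircle T → ℂ}

theorem norm_fourierCoeff_le_integral_norm (f : AddCircle T → ℂ) (n : ℤ) :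
    ‖fourierCoeff f n‖ ≤ ∫ x, ‖f x‖ ∂haarAddCircle := by
  refine (norm_integral_le_integral_norm _).trans_eq ?_
  simp only [norm_smul, fourier_apply, Circle.norm_coe, one_mul]

theorem tendstoInMeasure_fourier_series (hf : MemLp f 2 haarAddCircle) :
    TendstoInMeasure haarAddCircle
      (fun (s : Finset ℤ) x => ∑ n ∈ s, fourierCoeff f n * fourier n x) atTop f := by
  have hcoeff : fourierCoeff hf.toLp = fourierCoeff f := fourierCoeff_congr_ae hf.coeFn_toLp
  refine (tendstoInMeasure_of_tendsto_Lp (hasSum_fourier_series_L2 (T := T) hf.toLp)).congr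
    (fun s => ?_) hf.coeFn_toLp
  have hsmul : ∀ᵐ x ∂haarAddCircle, ∀ n : ℤ,
      (fourierCoeff hf.toLp n • fourierLp (T := T) 2 n : Lp ℂ 2 haarAddCircle) x =
        fourierCoeff f n * fourier n x := by
    refine ae_all_iff.mpr fun n => ?_
    filter_upwards [Lp.coeFn_smul (fourierCoeff hf.toLp n) (fourierLp (T := T) 2 n),
      coeFn_fourierLp 2 n] with x hx hx'
    rw [hx, Pi.smul_apply, hx', hcoeff, smul_eq_mul]
  filter_upwards [hsmul, Lp.coeFn_finsetSum s fun n =>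
    fourierCoeff hf.toLp n • fourierLp (T := T) 2 n] with x hx hx'
  rw [hx', Finset.sum_apply]
  exact Finset.sum_congr rfl fun n _ => hx n

theorem sum_sq_fourierCoeff_le (hf : MemLp f 2 haarAddCircle) (s : Finset ℤ) :
    ∑ n ∈ s, ‖fourierCoeff f n‖ ^ 2 ≤ ∫ x, ‖f x‖ ^ 2 ∂haarAddCircle := by
  have hnorm : (fun x => ‖hf.toLp f x‖ ^ 2) =ᵐ[haarAddCircle] fun x => ‖f x‖ ^ 2 := by
    filter_upwards [hf.coeFn_toLp] with x hx
    rw [hx]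
  rw [← fourierCoeff_congr_ae hf.coeFn_toLp, ← integral_congr_ae hnorm]
  exact sum_le_hasSum _ (fun _ _ => by positivity) (hasSum_sq_fourierCoeff hf.toLp)

/-- The indicator of an arc of length `κ` around `0`, normalised to have integral `1`. -/
noncomputable def arcDensity (κ : ℝ) : UnitAddCircle → ℂ :=
  (Metric.closedBall 0 (κ / 2)).indicator fun _ => (κ⁻¹ : ℂ)

theorem volume_arc {κ : ℝ} (hκ : κ ≤ 1) :
    volume (Metric.closedBall (0 : UnitAddCircle) (κ / 2)) = ENNReal.ofReal κ := by
  rw [volume_closedBall, mul_div_cancel₀ _ two_ne_zero, min_eq_right hκ]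

theorem integral_norm_arcDensity_pow {κ : ℝ} (hκ : 0 < κ) (hκ1 : κ ≤ 1) (n : ℕ) :
    ∫ x, ‖arcDensity κ x‖ ^ (n + 1) ∂haarAddCircle = κ⁻¹ ^ n := by
  have hpow (x : UnitAddCircle) : ‖arcDensity κ x‖ ^ (n + 1) =
      (Metric.closedBall 0 (κ / 2)).indicator (fun _ => κ⁻¹ ^ (n + 1)) x := by
    by_cases hx : x ∈ Metric.closedBall 0 (κ / 2)
    · simp only [arcDensity, Set.indicator_of_mem hx, norm_inv, Complex.norm_real,
        Real.norm_of_nonneg hκ.le]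
    · simp [arcDensity, Set.indicator_of_notMem hx]
  simp only [hpow]
  rw [integral_indicator_const _ Metric.isClosed_closedBall.measurableSet,
    haarAddCircle_one_eq_volume, measureReal_def, volume_arc hκ1, ENNReal.toReal_ofReal hκ.le,
    smul_eq_mul, pow_succ', mul_inv_cancel_left₀ hκ.ne']

theorem fourierCoeff_arcDensity_zero {κ : ℝ} (hκ : 0 < κ) (hκ1 : κ ≤ 1) :
    fourierCoeff (arcDensity κ) 0 = 1 := by
  simp only [fourierCoeff, neg_zero, fourier_zero, one_smul, arcDensity]
  rw [integral_indicator_const _ Metric.isClosed_closedBall.measurableSet,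
    haarAddCircle_one_eq_volume, measureReal_def, volume_arc hκ1, ENNReal.toReal_ofReal hκ.le,
    Complex.real_smul, mul_inv_cancel₀ (Complex.ofReal_ne_zero.mpr hκ.ne')]

theorem measure_lt_norm_le {α E : Type*} [MeasurableSpace α] [SeminormedAddCommGroup E]
    (μ : Measure α) (η : ℝ) {F G : α → E} {A : Set α} (hG : ∀ x ∉ A, G x = 0) :
    μ {x | η < ‖F x‖} ≤ μ {x | ENNReal.ofReal η ≤ edist (F x) (G x)} + μ A := by
  refine (measure_mono fun x (hx : η < _) => or_iff_not_imp_right.mpr fun hxA => ?_).trans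
    (measure_union_le _ _)
  change _ ≤ edist _ _
  rw [hG x hxA, edist_zero_right, ← ofReal_norm]
  exact ENNReal.ofReal_le_ofReal hx.le

theorem exists_trigPoly_nearOne_of_arc {κ η : ℝ} (hκ : 0 < κ) (hκ1 : κ ≤ 1) (hη : 0 < η) :
    ∃ c : ℤ →₀ ℂ, c 0 = 0 ∧ (∀ q : ℝ, 2 ≤ q → lqNorm q c ^ q ≤ κ⁻¹) ∧
      NearOneInMeasure volume η (ENNReal.ofReal (2 * κ)) (trigPoly c) := by
  set a := fourierCoeff (arcDensity κ)
  have ha1 (j : ℤ) : ‖a j‖ ≤ 1 := by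
    have hint := integral_norm_arcDensity_pow hκ hκ1 0
    simp only [zero_add, pow_one, pow_zero] at hint
    exact (norm_fourierCoeff_le_integral_norm _ j).trans_eq hint
  have hL2 : MemLp (arcDensity κ) 2 haarAddCircle :=
    memLp_indicator_const 2 Metric.isClosed_closedBall.measurableSet _ (Or.inr (measure_ne_top _ _))
  obtain ⟨s, hs, hs0⟩ := (((tendstoInMeasure_fourier_series hL2 (ENNReal.ofReal η)
    (by simpa)).eventually_le_const (by simpa : 0 < ENNReal.ofReal κ)).and
      (eventually_ge_atTop {0})).exists
  refine ⟨Finsupp.indicator (s.erase 0) fun j _ => -a j, by simp, fun q hq => ?_, ?_⟩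
  · rw [lqNorm_rpow (by positivity) (Finsupp.support_indicator_subset ..)]
    calc ∑ j ∈ s.erase 0, ‖Finsupp.indicator (s.erase 0) (fun j _ => -a j) j‖ ^ q
        ≤ ∑ j ∈ s.erase 0, ‖a j‖ ^ 2 := by
          refine Finset.sum_le_sum fun j hj => ?_
          rw [Finsupp.indicator_of_mem hj, norm_neg, ← Real.rpow_natCast]
          exact Real.rpow_le_rpow_of_exponent_ge' (norm_nonneg _) (ha1 j) (by positivity) hq
      _ ≤ ∫ x, ‖arcDensity κ x‖ ^ 2 ∂haarAddCircle := sum_sq_fourierCoeff_le hL2 _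
      _ = κ⁻¹ := by rw [integral_norm_arcDensity_pow hκ hκ1 1, pow_one]
  · have hpoly (x : UnitAddCircle) :
        ‖trigPoly (Finsupp.indicator (s.erase 0) fun j _ => -a j) x - 1‖ =
          ‖∑ j ∈ s, a j * fourier j x‖ := by
      rw [trigPoly_indicator, ← Finset.add_sum_erase _ _ (hs0 (Finset.mem_singleton_self 0)),
        show a 0 = 1 from fourierCoeff_arcDensity_zero hκ hκ1, ← norm_neg]
      simp only [neg_mul, Finset.sum_neg_distrib, fourier_zero]
      ring_nf
    simp only [NearOneInMeasure, hpoly]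
    calc volume {x | η < ‖∑ j ∈ s, a j * fourier j x‖}
        ≤ volume {x | ENNReal.ofReal η ≤ edist (∑ j ∈ s, a j * fourier j x) (arcDensity κ x)} +
            volume (Metric.closedBall (0 : UnitAddCircle) (κ / 2)) :=
          measure_lt_norm_le volume η fun _ hx => Set.indicator_of_notMem hx _
      _ ≤ ENNReal.ofReal κ + ENNReal.ofReal κ := by
          rw [volume_arc hκ1]
          gcongr
          rwa [← haarAddCircle_one_eq_volume]
      _ = ENNReal.ofReal (2 * κ) := by rw [← ENNReal.ofReal_add hκ.le hκ.le, two_mul]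

end Concentrated

section DilationAverage

variable {q η : ℝ} {c : ℤ →₀ ℂ} {n : ℤ}

theorem exists_natCast_gt_abs (s : Finset ℤ) : ∃ n : ℕ, ∀ j ∈ s, |j| < n :=
  ⟨s.sup Int.natAbs + 1, fun j hj => by
    rw [Int.abs_eq_natAbs, Nat.cast_lt, Nat.lt_succ_iff]
    exact Finset.le_sup hj⟩

theorem disjoint_support_mapDomain_pow_mul (hn : n ≠ 0) (hc : ∀ j ∈ c.support, ¬n ∣ j) :
    Pairwise fun i k : ℕ =>
      Disjoint (c.mapDomain (n ^ i * ·)).support (c.mapDomain (n ^ k * ·)).support := by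
  refine (pairwise_disjoint_on fun i : ℕ => (c.mapDomain (n ^ i * ·)).support).mpr ?_
  intro i k hik
  refine Finset.disjoint_left.mpr fun l hi hk => ?_
  obtain ⟨j, hj, rfl⟩ := Finset.mem_image.mp (Finsupp.mapDomain_support hi)
  obtain ⟨j', -, hjj'⟩ := Finset.mem_image.mp (Finsupp.mapDomain_support hk)
  refine hc j hj ((dvd_pow_self n (Nat.sub_ne_zero_of_lt hik)).trans ⟨j', ?_⟩)
  refine mul_left_cancel₀ (pow_ne_zero i hn) ?_
  rw [← mul_assoc, ← pow_add, Nat.add_sub_cancel' hik.le]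
  exact hjj'.symm

/-- The coefficients of the average of the `m` dilates `x ↦ f (n ^ i • x)`, where `f` is the
trigonometric polynomial with coefficients `c`. -/
noncomputable def dilationAverage (m : ℕ) (n : ℤ) (c : ℤ →₀ ℂ) : ℤ →₀ ℂ :=
  (m : ℂ)⁻¹ • ∑ i ∈ Finset.range m, c.mapDomain (n ^ i * ·)

theorem dilationAverage_apply_zero (m : ℕ) (hn : n ≠ 0) (hc : c 0 = 0) :
    dilationAverage m n c 0 = 0 := by
  have hterm (i : ℕ) : c.mapDomain (n ^ i * ·) 0 = 0 := by
    simpa [hc] using Finsupp.mapDomain_apply (mul_right_injective₀ (pow_ne_zero i hn)) c 0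
  simp [dilationAverage, hterm]

theorem lqNorm_rpow_dilationAverage (hq : 0 < q) (m : ℕ) (hn : n ≠ 0)
    (hc : ∀ j ∈ c.support, ¬n ∣ j) :
    lqNorm q (dilationAverage m n c) ^ q = (m : ℝ)⁻¹ ^ q * (m * lqNorm q c ^ q) := by
  have hinj (i : ℕ) : Function.Injective (n ^ i * ·) := mul_right_injective₀ (pow_ne_zero i hn)
  rw [dilationAverage, lqNorm_smul hq.ne', Real.mul_rpow (norm_nonneg _) (lqNorm_nonneg _ _),
    lqNorm_sum_rpow_of_disjoint hq.ne' (disjoint_support_mapDomain_pow_mul hn hc)]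
  simp only [lqNorm_mapDomain (hinj _), Finset.sum_const, Finset.card_range, nsmul_eq_mul,
    norm_inv, Complex.norm_natCast]

theorem NearOneInMeasure.trigPoly_dilationAverage {m : ℕ} {δ : ℝ≥0∞} (hm : m ≠ 0) (hn : n ≠ 0)
    (hc : NearOneInMeasure volume η δ (trigPoly c)) :
    NearOneInMeasure volume η (m * δ) (trigPoly (dilationAverage m n c)) := by
  have h := NearOneInMeasure.average (Finset.nonempty_range_iff.mpr hm) fun i _ =>
    hc.trigPoly_dilate (pow_ne_zero i hn)
  simpa [NearOneInMeasure, dilationAverage, ContinuousMap.sum_apply] using h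

theorem exists_trigPoly_lqNorm_le_nearOne (hq : 2 < q) (hη : 0 < η) :
    ∃ c : ℤ →₀ ℂ, c 0 = 0 ∧ lqNorm q c ≤ η ∧
      NearOneInMeasure volume η (ENNReal.ofReal η) (trigPoly c) := by
  have hlim : Tendsto (fun m : ℕ => (m : ℝ) ^ (-(q - 2)) * (2 / η)) atTop (𝓝 0) := by
    simpa using ((tendsto_rpow_neg_atTop (sub_pos.mpr hq)).comp
      tendsto_natCast_atTop_atTop).mul_const (2 / η)
  obtain ⟨m, hmass, hm, hm0⟩ := ((hlim.eventually_le_const (by positivity : 0 < η ^ q)).and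
    ((tendsto_natCast_atTop_atTop.eventually_ge_atTop (η / 2)).and (eventually_ne_atTop 0))).exists
  have hm0' : (0 : ℝ) < m := by positivity
  obtain ⟨c, hc0, hcq, hc⟩ := exists_trigPoly_nearOne_of_arc (κ := η / 2 / m) (by positivity)
    (div_le_one_of_le₀ hm hm0'.le) hη
  obtain ⟨n, hn⟩ := exists_natCast_gt_abs (insert 0 c.support)
  have hn0 : (n : ℤ) ≠ 0 := by simpa using (hn 0 (Finset.mem_insert_self ..)).ne'
  have hndvd : ∀ j ∈ c.support, ¬(n : ℤ) ∣ j := fun j hj hdvd => by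
    refine Finsupp.mem_support_iff.mp hj ?_
    rw [Int.eq_zero_of_abs_lt_dvd hdvd (hn j (Finset.mem_insert_of_mem hj)), hc0]
  refine ⟨dilationAverage m n c, dilationAverage_apply_zero m hn0 hc0, ?_, ?_⟩
  · rw [← Real.rpow_le_rpow_iff (lqNorm_nonneg _ _) hη.le (by positivity : 0 < q),
      lqNorm_rpow_dilationAverage (by positivity) m hn0 hndvd]
    calc (m : ℝ)⁻¹ ^ q * (m * lqNorm q c ^ q) ≤ (m : ℝ)⁻¹ ^ q * (m * (η / 2 / m)⁻¹) := by
          gcongr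
          exact hcq q hq.le
      _ = (m : ℝ) ^ (-(q - 2)) * (2 / η) := by
          rw [Real.inv_rpow hm0'.le, ← Real.rpow_neg hm0'.le, neg_sub, sub_eq_neg_add,
            Real.rpow_add hm0', Real.rpow_two]
          field_simp
      _ ≤ η ^ q := hmass
  · refine (hc.trigPoly_dilationAverage hm0 hn0).mono le_rfl (le_of_eq ?_)
    rw [← ENNReal.ofReal_natCast, ← ENNReal.ofReal_mul hm0'.le]
    field_simp

end DilationAverage

section Modulation

open Polynomial

variable {q η : ℝ}

/-- The coefficients of `p (e (n x)) * f x`, where `f` is the trigonometric polynomial with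
coefficients `c`. -/
noncomputable def modulate (p : ℂ[X]) (n : ℤ) (c : ℤ →₀ ℂ) : ℤ →₀ ℂ :=
  p.sum fun k z => z • c.mapDomain (n * k + ·)

theorem trigPoly_modulate (p : ℂ[X]) (n : ℤ) (c : ℤ →₀ ℂ) (x : UnitAddCircle) :
    trigPoly (modulate p n c) x = p.eval (fourier 1 (n • x)) * trigPoly c x := by
  have hpow (k : ℕ) : (fourier (n * k) x : ℂ) = fourier 1 (n • x) ^ k := by
    rw [fourier_apply, fourier_apply, one_smul, mul_comm, mul_smul, natCast_zsmul,
      AddCircle.toCircle_nsmul, Circle.coe_pow]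
  simp only [modulate, Polynomial.sum, map_sum, map_smul, ContinuousMap.sum_apply,
    ContinuousMap.smul_apply, trigPoly_mapDomain_add, eval_eq_sum, Finset.sum_mul, hpow,
    smul_eq_mul, mul_assoc]

theorem lqNorm_modulate_le (hq : 1 ≤ q) (p : ℂ[X]) (n : ℤ) (c : ℤ →₀ ℂ) :
    lqNorm q (modulate p n c) ≤ (p.sum fun _ z => ‖z‖) * lqNorm q c := by
  refine (lqNorm_sum_le hq _ _).trans_eq ?_
  simp only [lqNorm_smul (ne_of_gt (one_pos.trans_le hq)), lqNorm_mapDomain (add_right_injective _),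
    Polynomial.sum, Finset.sum_mul]

theorem pos_of_mem_support_modulate {p : ℂ[X]} (hp : p.coeff 0 = 0) {n : ℤ} {c : ℤ →₀ ℂ}
    (hn : ∀ j ∈ c.support, |j| < n) {i : ℤ} (hi : i ∈ (modulate p n c).support) : 0 < i := by
  obtain ⟨k, hk, hik⟩ := Finset.mem_biUnion.mp (Finsupp.support_finsetSum hi)
  obtain ⟨j, hj, rfl⟩ :=
    Finset.mem_image.mp (Finsupp.mapDomain_support (Finsupp.support_smul hik))
  have hk1 : 1 ≤ (k : ℤ) := by
    rw [Nat.one_le_cast, Nat.one_le_iff_ne_zero]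
    rintro rfl
    exact mem_support_iff.mp hk hp
  have hjn := abs_lt.mp (hn j hj)
  nlinarith

theorem exists_nat_mapDomain_eq {c : ℤ →₀ ℂ} (hc : ∀ i ∈ c.support, 0 < i) :
    ∃ d : ℕ →₀ ℂ, d 0 = 0 ∧ d.mapDomain (Nat.cast : ℕ → ℤ) = c := by
  refine ⟨c.comapDomain Nat.cast Nat.cast_injective.injOn, ?_,
    Finsupp.mapDomain_comapDomain _ Nat.cast_injective c fun i hi => ⟨i.toNat, ?_⟩⟩
  · by_contra h0
    exact (hc 0 (Finsupp.mem_support_iff.mpr h0)).false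
  · exact Int.toNat_of_nonneg (hc i hi).le

theorem exists_analytic_trigPoly_lqNorm_le_nearOne (hq : 2 < q) (hη : 0 < η) :
    ∃ c : ℕ →₀ ℂ, c 0 = 0 ∧ lqNorm q c ≤ η ∧
      NearOneInMeasure volume η (ENNReal.ofReal η) (trigPoly (c.mapDomain Nat.cast)) := by
  set θ : ℝ := min η 1 / 3 with hθ
  have hθ0 : 0 < θ := by positivity
  have hθη : 3 * θ ≤ η := by linarith [min_le_left η 1]
  have hθ1 : θ ≤ 1 := by linarith [min_le_right η 1]
  obtain ⟨p, hp0, hp⟩ := exists_polynomial_nearOne hθ0 (ENNReal.ofReal_pos.mpr hθ0).ne'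
  set A : ℝ := p.sum fun _ z => ‖z‖
  have hA : 0 ≤ A := Finset.sum_nonneg fun _ _ => norm_nonneg _
  obtain ⟨e, -, heq, he⟩ := exists_trigPoly_lqNorm_le_nearOne hq
    (by positivity : 0 < min θ (θ / (A + 1)))
  obtain ⟨n, hn⟩ := exists_natCast_gt_abs (insert 0 e.support)
  have hn0 : (n : ℤ) ≠ 0 := by simpa using (hn 0 (Finset.mem_insert_self ..)).ne'
  obtain ⟨c, hc0, hc⟩ := exists_nat_mapDomain_eq fun i => pos_of_mem_support_modulate hp0
    fun j hj => hn j (Finset.mem_insert_of_mem hj)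
  refine ⟨c, hc0, ?_, ?_⟩
  · rw [← lqNorm_mapDomain (Nat.cast_injective (R := ℤ)), hc]
    calc _ ≤ A * lqNorm q e := lqNorm_modulate_le (by linarith) p n e
      _ ≤ A * (θ / (A + 1)) := by
        gcongr
        exact heq.trans (min_le_right _ _)
      _ ≤ θ := by
        rw [mul_div_assoc', div_le_iff₀ (by positivity)]
        linarith
      _ ≤ η := by linarith
  · have hpn := hp.comp_measurePreserving (by fun_prop) (Measure.measurePreserving_zsmul volume hn0)
    simp only [hc, NearOneInMeasure, trigPoly_modulate]
    refine (hpn.mul (he.mono (min_le_left _ _)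
      (ENNReal.ofReal_le_ofReal (min_le_left _ _))) hθ1).mono hθη ?_
    rw [← ENNReal.ofReal_add hθ0.le hθ0.le]
    exact ENNReal.ofReal_le_ofReal (by linarith)

end Modulation

section AlmostLacunary

theorem exists_separated_positions (T N : ℕ → ℕ) :
    ∃ s : ℕ → ℕ, (∀ k, T k ≤ s k) ∧ ∀ k l, k < l → s k + N k < s l := by
  set s : ℕ → ℕ := fun k => ∑ i ∈ Finset.range (k + 1), T i + ∑ i ∈ Finset.range k, (N i + 1)
    with hs
  have hstep : ∀ k, s k + N k < s (k + 1) := fun k => by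
    simp only [hs, Finset.sum_range_succ _ (k + 1), Finset.sum_range_succ _ k]
    omega
  have hmono : Monotone s := monotone_nat_of_le_succ fun k => by have := hstep k; omega
  refine ⟨s, fun k => ?_, fun k l hkl => (hstep k).trans_le (hmono hkl)⟩
  simp only [hs, Finset.sum_range_succ]
  omega

open Classical in
theorem exists_block_starts {s N : ℕ → ℕ} (hs : ∀ k l, k < l → s k + N k < s l) :
    ∃ σ : ℕ → ℕ, (∀ n, σ n ≤ n) ∧ (∀ k, ∀ j ∈ Finset.Icc 1 (N k), σ (s k + j) = s k + 1) ∧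
      ∀ n, σ (n + 1) = n + 1 ∨
        σ (n + 1) = σ n ∧ ∃ k, σ n = s k + 1 ∧ n + 1 ≤ s k + N k := by
  set cont : Set ℕ := {n | ∃ k, s k + 1 < n ∧ n ≤ s k + N k}
  set σ : ℕ → ℕ := Nat.findGreatest (· ∉ cont)
  have hstart : ∀ n, n + 1 ∉ cont → σ (n + 1) = n + 1 := fun n =>
    Nat.findGreatest_eq (P := (· ∉ cont))
  have hcont : ∀ n, n + 1 ∈ cont → σ (n + 1) = σ n := fun n hn =>
    Nat.findGreatest_of_not (not_not.mpr hn)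
  have hblock : ∀ k, ∀ j ≥ 1, j ≤ N k → σ (s k + j) = s k + 1 := by
    intro k j hj
    induction j, hj using Nat.le_induction with
    | base =>
      refine fun hk => hstart _ ?_
      rintro ⟨l, hl, hl'⟩
      rcases lt_trichotomy k l with h | rfl | h
      · have := hs k l h; omega
      · omega
      · have := hs l k h; omega
    | succ j hj ih =>
      exact fun hj' => (hcont (s k + j) ⟨k, by omega, by omega⟩).trans (ih (by omega))
  refine ⟨σ, fun n => Nat.findGreatest_le n, fun k j hj => ?_, fun n => ?_⟩
  · exact hblock k j (Finset.mem_Icc.mp hj).1 (Finset.mem_Icc.mp hj).2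
  by_cases hn : n + 1 ∈ cont
  · refine .inr ⟨hcont n hn, ?_⟩
    obtain ⟨k, hk, hk'⟩ := hn
    obtain ⟨j, rfl⟩ := Nat.exists_eq_add_of_le (show s k ≤ n by omega)
    exact ⟨k, hblock k j (by omega) (by omega), hk'⟩
  · exact .inl (hstart n hn)

theorem exists_block_starts_abs_mul_lt_one {ε : ℕ → ℝ} (hlim : Tendsto ε atTop (𝓝 0))
    (N : ℕ → ℕ) :
    ∃ s σ : ℕ → ℕ, s.Injective ∧ (∀ n, σ n ≤ n) ∧
      (∀ k, ∀ j ∈ Finset.Icc 1 (N k), σ (s k + j) = s k + 1) ∧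
      ∀ n, σ (n + 1) = n + 1 ∨ σ (n + 1) = σ n ∧ |ε n| * (n + 2 - σ n) < 1 := by
  have hT : ∀ k, ∃ T : ℕ, ∀ n ≥ T, |ε n| * N k < 1 := fun k => by
    have := hlim.abs.mul_const (N k : ℝ)
    rw [abs_zero, zero_mul] at this
    exact eventually_atTop.mp (this.eventually_lt_const one_pos)
  choose T hT using hT
  obtain ⟨s, hsT, hsN⟩ := exists_separated_positions T N
  obtain ⟨σ, hσ, hblock, hstep⟩ := exists_block_starts hsN
  refine ⟨s, σ, (strictMono_nat_of_lt_succ fun k =>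
    (Nat.le_add_right _ _).trans_lt (hsN k (k + 1) k.lt_succ_self)).injective, hσ, hblock,
    fun n => (hstep n).imp_right fun ⟨hn, k, hk, hnk⟩ => ⟨hn, ?_⟩⟩
  have hTn : T k ≤ n := by
    have := hσ n
    have := hsT k
    omega
  have hnk' : (n : ℝ) + 1 ≤ s k + N k := by exact_mod_cast hnk
  refine lt_of_le_of_lt ?_ (hT k n hTn)
  rw [hk]
  gcongr
  push_cast
  linarith

theorem exists_monotone_nat_mul_le_succ (A : ℕ → ℝ) :
    ∃ D : ℕ → ℕ, Monotone D ∧ (∀ n, A n ≤ D n) ∧ ∀ n, A n * D n ≤ D (n + 1) := by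
  set M : ℕ → ℕ := fun i => ⌈A i⌉₊ + 1
  set P : ℕ → ℕ := fun n => ∏ i ∈ Finset.range n, M i
  have hP : ∀ n, P (n + 1) = P n * M n := fun n => Finset.prod_range_succ M n
  have hM : ∀ n, 1 ≤ M n := fun n => Nat.le_add_left 1 _
  have hP1 : ∀ n, 1 ≤ P n := fun n => Finset.one_le_prod' fun i _ => hM i
  have hA : ∀ n, A n ≤ M n := fun n =>
    (Nat.le_ceil (A n)).trans (Nat.cast_le.mpr (Nat.le_add_right _ 1))
  have hPmono : Monotone P := monotone_nat_of_le_succ fun n => by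
    rw [hP]; exact Nat.le_mul_of_pos_right _ (hM n)
  refine ⟨fun n => P n * P (n + 1), fun m n hmn => ?_, fun n => ?_, fun n => ?_⟩
  · exact Nat.mul_le_mul (hPmono hmn) (hPmono (Nat.succ_le_succ hmn))
  · refine (hA n).trans (Nat.cast_le.mpr ?_)
    simp only [hP, ← mul_assoc]
    exact Nat.le_mul_of_pos_left _ (Nat.mul_pos (hP1 n) (hP1 n))
  · calc A n * ((P n * P (n + 1) : ℕ) : ℝ)
        ≤ (M n : ℝ) * ((P n * P (n + 1) : ℕ) : ℝ) := by gcongr; exact hA n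
      _ = ((P (n + 1) * P (n + 1) : ℕ) : ℝ) := by rw [hP]; push_cast; ring
      _ ≤ ((P (n + 1) * P (n + 1 + 1) : ℕ) : ℝ) := by
        exact_mod_cast Nat.mul_le_mul_left _ (hPmono (Nat.le_succ _))

/-- The sequence consisting of arithmetic progressions, one after another: if the current
progression was started at the index `i = σ n`, its terms are `a i + D i * j`, `j = 1, 2, …`. -/
def concatProgressions (a : ℕ → ℝ) (D σ : ℕ → ℕ) (n : ℕ) : ℝ :=
  a (σ n) + D (σ n) * (n + 1 - σ n)

section Concat

variable {ε a : ℕ → ℝ} {D σ : ℕ → ℕ}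

theorem concatProgressions_pos (hσ : ∀ n, σ n ≤ n) (ha : ∀ n, 2 * |a n| + 2 ≤ D n) (n : ℕ) :
    0 < concatProgressions a D σ n := by
  have hn : (1 : ℝ) ≤ n + 1 - σ n := by
    have : (σ n : ℝ) ≤ n := Nat.cast_le.mpr (hσ n)
    linarith
  have hD := le_mul_of_one_le_right (Nat.cast_nonneg (D (σ n)) : (0 : ℝ) ≤ _) hn
  rw [concatProgressions]
  linarith [ha (σ n), neg_abs_le (a (σ n)), abs_nonneg (a (σ n))]

theorem concatProgressions_le (ha : ∀ n, 2 * |a n| + 2 ≤ D n) (n : ℕ) :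
    concatProgressions a D σ n ≤ D (σ n) * (n + 2 - σ n) := by
  rw [concatProgressions]
  linarith [ha (σ n), le_abs_self (a (σ n)), abs_nonneg (a (σ n))]

theorem concatProgressions_growth (hσ : ∀ n, σ n ≤ n)
    (hstep : ∀ n, σ (n + 1) = n + 1 ∨ σ (n + 1) = σ n ∧ |ε n| * (n + 2 - σ n) < 1)
    (hD : Monotone D) (ha : ∀ n, 2 * |a n| + 2 ≤ D n)
    (hDε : ∀ n, 2 * (1 + |ε n|) * (n + 2) * D n ≤ D (n + 1)) (n : ℕ) :
    (1 + ε n) * concatProgressions a D σ n < concatProgressions a D σ (n + 1) ∧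
      concatProgressions a D σ n + 1 ≤ concatProgressions a D σ (n + 1) := by
  have hle := concatProgressions_le (σ := σ) ha n
  have hpos := concatProgressions_pos hσ ha n
  have hε : ε n * concatProgressions a D σ n ≤ |ε n| * concatProgressions a D σ n :=
    mul_le_mul_of_nonneg_right (le_abs_self _) hpos.le
  have hε0 := mul_nonneg (abs_nonneg (ε n)) hpos.le
  rcases hstep n with hn | ⟨hn, hlt⟩
  · have hnew : concatProgressions a D σ (n + 1) = a (n + 1) + D (n + 1) := by
      rw [concatProgressions, hn, add_sub_cancel_left, mul_one]
    have hhalf : (1 + |ε n|) * concatProgressions a D σ n ≤ D (n + 1) / 2 := by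
      calc (1 + |ε n|) * concatProgressions a D σ n
          ≤ (1 + |ε n|) * (D n * (n + 2)) := by
            refine mul_le_mul_of_nonneg_left (hle.trans ?_) (by positivity)
            have : (D (σ n) : ℝ) ≤ D n := Nat.cast_le.mpr (hD (hσ n))
            have : (σ n : ℝ) ≤ n := Nat.cast_le.mpr (hσ n)
            gcongr
            · linarith
            · linarith [(Nat.cast_nonneg (σ n) : (0 : ℝ) ≤ σ n)]
        _ ≤ D (n + 1) / 2 := by linarith [hDε n]
    rw [hnew]
    constructor <;> linarith [ha (n + 1), neg_abs_le (a (n + 1))]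
  · have hnext : concatProgressions a D σ (n + 1) = concatProgressions a D σ n + D (σ n) := by
      rw [concatProgressions, concatProgressions, hn]; push_cast; ring
    have hD0 : (0 : ℝ) < D (σ n) := by linarith [ha (σ n), abs_nonneg (a (σ n))]
    have hinc : |ε n| * concatProgressions a D σ n < D (σ n) := by
      calc |ε n| * concatProgressions a D σ n ≤ |ε n| * (D (σ n) * (n + 2 - σ n)) := by gcongr
        _ = D (σ n) * (|ε n| * (n + 2 - σ n)) := by ring
        _ < D (σ n) := mul_lt_of_lt_one_right hD0 hlt
    rw [hnext]
    constructor <;> linarith [ha (σ n), abs_nonneg (a (σ n))]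

end Concat

theorem pairwise_one_le_abs_sub {lam : ℕ → ℝ} (h : ∀ n, lam n + 1 ≤ lam (n + 1)) :
    Pairwise fun m n => 1 ≤ |lam m - lam n| := by
  have hlt : ∀ m n, m < n → lam m + 1 ≤ lam n := fun m n hmn =>
    (h m).trans (monotone_nat_of_le_succ (fun n => by linarith [h n]) (Nat.succ_le_of_lt hmn))
  intro m n hmn
  rw [le_abs]
  rcases hmn.lt_or_gt with hmn | hmn
  · exact .inr (by linarith [hlt m n hmn])
  · exact .inl (by linarith [hlt n m hmn])

theorem exists_almost_lacunary_seq {ε : ℕ → ℝ} (hlim : Tendsto ε atTop (𝓝 0)) (N : ℕ → ℕ)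
    (ν : ℕ → ℝ) :
    ∃ (lam : ℕ → ℝ) (s D : ℕ → ℕ), (∀ k, D k ≠ 0) ∧
      (∀ k, ∀ j ∈ Finset.Icc 1 (N k), lam (s k + j) = ν k + D k * j) ∧
      (∀ n, 0 < lam n) ∧ (∀ n, (1 + ε n) * lam n < lam (n + 1)) ∧
      Pairwise fun m n => 1 ≤ |lam m - lam n| := by
  obtain ⟨s, σ, hs, hσ, hblock, hstep⟩ := exists_block_starts_abs_mul_lt_one hlim N
  set a : ℕ → ℝ := Function.extend (fun k => s k + 1) ν 0
  have hsucc : Function.Injective fun k => s k + 1 := (add_left_injective 1).comp hs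
  obtain ⟨D, hDmono, hAD, hDsucc⟩ := exists_monotone_nat_mul_le_succ fun n =>
    2 * |a n| + 2 + 2 * (1 + |ε n|) * (n + 2)
  have ha : ∀ n, 2 * |a n| + 2 ≤ D n := fun n => by
    have : 0 ≤ 2 * (1 + |ε n|) * ((n : ℝ) + 2) := by positivity
    linarith [hAD n]
  have hDε : ∀ n, 2 * (1 + |ε n|) * (n + 2) * D n ≤ D (n + 1) := fun n => by
    have : 0 ≤ (2 * |a n| + 2) * D n := by positivity
    linarith [hDsucc n]
  have hgrowth := concatProgressions_growth hσ hstep hDmono ha hDε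
  refine ⟨concatProgressions a D σ, s, fun k => D (s k + 1), fun k hk => ?_, fun k j hj => ?_,
    concatProgressions_pos hσ ha, fun n => (hgrowth n).1,
    pairwise_one_le_abs_sub fun n => (hgrowth n).2⟩
  · have := ha (s k + 1)
    rw [show D (s k + 1) = 0 from hk, Nat.cast_zero] at this
    linarith [abs_nonneg (a (s k + 1))]
  · rw [concatProgressions, hblock k j hj, show a (s k + 1) = ν k from hsucc.extend_apply ν 0 k]
    push_cast
    ring

end AlmostLacunary

open scoped FourierTransform SchwartzMap ContDiff

section FourierL2

theorem integral_mul_fourier_L2 (f : L2R) (φ : 𝓢(ℝ, ℂ)) :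
    ∫ x, φ x * (𝓕 f : L2R) x = ∫ x, 𝓕 (φ : ℝ → ℂ) x * f x := by
  have h := congrArg (fun T => T φ) (Lp.fourier_toTemperedDistribution_eq f)
  simp only [TemperedDistribution.fourier_apply, Lp.toTemperedDistribution_apply,
    smul_eq_mul] at h
  rw [← h]
  rfl

theorem fourier_L2_ae_eq {f : L2R} {F : ℝ → ℂ} (hF : LocallyIntegrable F)
    (h : ∀ φ : ℝ → ℂ, ContDiff ℝ ∞ φ → HasCompactSupport φ →
      ∫ x, φ x * F x = ∫ x, 𝓕 φ x * f x) : (𝓕 f : L2R) =ᵐ[volume] F := by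
  refine ae_eq_of_integral_contDiff_smul_eq
    ((Lp.memLp (𝓕 f : L2R)).locallyIntegrable (by norm_num)) hF fun ψ hψ hc => ?_
  have hψ' : ContDiff ℝ ∞ fun x => (ψ x : ℂ) := Complex.ofRealCLM.contDiff.comp hψ
  have hc' : HasCompactSupport fun x => (ψ x : ℂ) := hc.comp_left Complex.ofReal_zero
  simp only [Complex.real_smul]
  rw [h _ hψ' hc']
  exact integral_mul_fourier_L2 f (hc'.toSchwartzMap hψ')

theorem fourier_mul_fourierChar (φ : ℝ → ℂ) (a x : ℝ) :
    𝓕 (fun y => φ y * (𝐞 (-(a * y)) : ℂ)) x = 𝓕 φ (x + a) := by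
  rw [Real.fourier_real_eq, Real.fourier_real_eq]
  congr 1 with y
  rw [Circle.smul_def, Circle.smul_def, smul_eq_mul, smul_eq_mul, mul_add, neg_add,
    AddChar.map_add_eq_mul, Circle.coe_mul, mul_comm y a]
  ring

theorem fourier_translateL2 (f : L2R) (a : ℝ) : (𝓕 (translateL2 f a) : L2R) =ᵐ[volume]
    fun ξ => (𝐞 (-(a * ξ)) : ℂ) * (𝓕 f : L2R) ξ := by
  have hsmooth : ContDiff ℝ ∞ fun ξ : ℝ => (𝐞 (-(a * ξ)) : ℂ) := by
    simp only [Real.fourierChar_apply]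
    exact ((Complex.ofRealCLM.contDiff.comp
      (by fun_prop : ContDiff ℝ ∞ fun ξ : ℝ => 2 * Real.pi * -(a * ξ))).mul contDiff_const).cexp
  refine fourier_L2_ae_eq ?_ fun φ hφ hc => ?_
  · refine MemLp.locallyIntegrable (p := 2) ((Lp.memLp (𝓕 f : L2R)).mono
      (hsmooth.continuous.aestronglyMeasurable.mul (Lp.aestronglyMeasurable _))
      (ae_of_all _ fun ξ => ?_)) (by norm_num)
    rw [norm_mul, Circle.norm_coe, one_mul]
  · have hc' : HasCompactSupport fun x => φ x * (𝐞 (-(a * x)) : ℂ) := hc.mul_right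
    calc ∫ x, φ x * ((𝐞 (-(a * x)) : ℂ) * (𝓕 f : L2R) x)
        = ∫ x, (φ x * (𝐞 (-(a * x)) : ℂ)) * (𝓕 f : L2R) x := by simp_rw [mul_assoc]
      _ = ∫ x, 𝓕 (fun x => φ x * (𝐞 (-(a * x)) : ℂ)) x * f x :=
        integral_mul_fourier_L2 f (hc'.toSchwartzMap (hφ.mul hsmooth))
      _ = ∫ x, 𝓕 φ (x + a) * f x := by simp_rw [fourier_mul_fourierChar]
      _ = ∫ x, 𝓕 φ x * f (x - a) := by
        rw [← integral_sub_right_eq_self _ a]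
        simp only [sub_add_cancel]
      _ = ∫ x, 𝓕 φ x * translateL2 f a x :=
        integral_congr_ae ((coeFn_translateL2 f a).symm.mono fun x hx => by simp only [hx])

theorem integral_mul_fourier_integrable {F φ : ℝ → ℂ} (hF : Integrable F) (hφ : Integrable φ) :
    ∫ x, φ x * 𝓕 F x = ∫ x, 𝓕 φ x * F x := by
  have := VectorFourier.integral_fourierIntegral_smul_eq_flip (e := 𝐞) (μ := volume) (ν := volume)
    (L := innerₗ ℝ) (f := φ) (g := F) Real.continuous_fourierChar (by fun_prop) hφ hF
  simp only [flip_innerₗ, smul_eq_mul] at this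
  exact this.symm

theorem continuous_fourier_of_integrable {F : ℝ → ℂ} (hF : Integrable F) : Continuous (𝓕 F) :=
  VectorFourier.fourierIntegral_continuous Real.continuous_fourierChar (by fun_prop) hF

theorem fourier_toLp_ae_eq {F : ℝ → ℂ} (hF : Integrable F) (hF2 : MemLp F 2 volume) :
    (𝓕 hF2.toLp : L2R) =ᵐ[volume] 𝓕 F := by
  refine fourier_L2_ae_eq (continuous_fourier_of_integrable hF).locallyIntegrable
    fun φ hφ hc => ?_
  rw [integral_mul_fourier_integrable hF (hφ.continuous.integrable_of_hasCompactSupport hc)]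
  exact integral_congr_ae (hF2.coeFn_toLp.symm.mono fun x hx => by simp only [hx])

theorem ae_eq_zero_of_fourier_eq_zero {F : ℝ → ℂ} (hF : Integrable F) (h : ∀ ξ, 𝓕 F ξ = 0) :
    F =ᵐ[volume] 0 := by
  refine ae_eq_zero_of_integral_contDiff_smul_eq_zero hF.locallyIntegrable fun ψ hψ hc => ?_
  have hψ' : ContDiff ℝ ∞ fun x => (ψ x : ℂ) := Complex.ofRealCLM.contDiff.comp hψ
  have hc' : HasCompactSupport fun x => (ψ x : ℂ) := hc.comp_left Complex.ofReal_zero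
  set Ψ : 𝓢(ℝ, ℂ) := hc'.toSchwartzMap hψ'
  have hint := integral_mul_fourier_integrable hF (φ := (𝓕⁻ Ψ : 𝓢(ℝ, ℂ))) (𝓕⁻ Ψ).integrable
  rw [← SchwartzMap.fourier_coe, FourierTransform.fourier_fourierInv_eq] at hint
  simp only [h, mul_zero, integral_zero] at hint
  simp only [Complex.real_smul]
  exact hint.symm

theorem span_translates_dense {S : Set ℝ} (hS : Dense S) {g : L2R}
    (hg : ∀ᵐ ξ : ℝ, (𝓕 g : L2R) ξ ≠ 0) :
    (Submodule.span ℂ (translateL2 g '' S)).topologicalClosure = ⊤ := by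
  rw [Submodule.topologicalClosure_eq_top_iff, Submodule.eq_bot_iff]
  intro h hh
  set F : ℝ → ℂ := fun ξ => inner ℂ ((𝓕 h : L2R) ξ) ((𝓕 g : L2R) ξ) with hF
  have hFint : Integrable F := L2.integrable_inner (𝓕 h : L2R) (𝓕 g : L2R)
  have hFS : ∀ a ∈ S, 𝓕 F a = 0 := by
    intro a ha
    have horth : inner ℂ h (translateL2 g a) = 0 :=
      Submodule.inner_left_of_mem_orthogonal
        (Submodule.subset_span (Set.mem_image_of_mem (translateL2 g) ha)) hh
    rw [← Lp.inner_fourier_eq, L2.inner_def] at horth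
    rw [Real.fourier_real_eq, ← horth]
    refine integral_congr_ae ?_
    filter_upwards [fourier_translateL2 g a] with ξ hξ
    rw [hξ, Circle.smul_def, hF, mul_comm ξ]
    simp only [RCLike.inner_apply, smul_eq_mul]
    ring
  have hF0 : 𝓕 F = fun _ => 0 :=
    (continuous_fourier_of_integrable hFint).ext_on hS continuous_const hFS
  have hh0 : (𝓕 h : L2R) = 0 := by
    rw [Lp.eq_zero_iff_ae_eq_zero]
    filter_upwards [ae_eq_zero_of_fourier_eq_zero hFint (congrFun hF0), hg] with ξ hξ hgξ
    simpa [hF, hgξ] using hξ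
  rw [← norm_eq_zero, ← Lp.norm_fourier_eq, hh0, norm_zero]

/-- The exponential sum with frequencies `-a j` and coefficients `c j`. It is the symbol of the
combination of translates `f ↦ ∑ c j • f (· - a j)`. -/
noncomputable def expSum {ι : Type*} (a : ι → ℝ) (c : ι →₀ ℂ) (ξ : ℝ) : ℂ :=
  c.sum fun j z => z * (𝐞 (-(a j * ξ)) : ℂ)

theorem fourier_linearCombination_translateL2 {ι : Type*} (g : L2R) (a : ι → ℝ) (c : ι →₀ ℂ) :
    (𝓕 (Finsupp.linearCombination ℂ (fun j => translateL2 g (a j)) c) : L2R) =ᵐ[volume]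
      fun ξ => expSum a c ξ * (𝓕 g : L2R) ξ := by
  induction c using Finsupp.induction_linear with
  | zero =>
    rw [map_zero, FourierTransform.fourier_zero]
    filter_upwards [Lp.coeFn_zero ℂ 2 (volume : Measure ℝ)] with ξ hξ
    rw [hξ, expSum, Finsupp.sum_zero_index, zero_mul, Pi.zero_apply]
  | add c d hc hd =>
    rw [map_add, FourierTransform.fourier_add]
    refine (Lp.coeFn_add _ _).trans ?_
    filter_upwards [hc, hd] with ξ hcξ hdξ
    rw [Pi.add_apply, hcξ, hdξ, ← add_mul]
    simp only [expSum]
    rw [Finsupp.sum_add_index' (fun _ => zero_mul _) (fun _ _ _ => add_mul _ _ _)]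
  | single j z =>
    rw [Finsupp.linearCombination_single, FourierTransform.fourier_smul]
    filter_upwards [Lp.coeFn_smul z (𝓕 (translateL2 g (a j)) : L2R),
      fourier_translateL2 g (a j)] with ξ hsmul htrans
    rw [hsmul, Pi.smul_apply, htrans, expSum, Finsupp.sum_single_index (zero_mul _), smul_eq_mul,
      mul_assoc]

end FourierL2

section UnitIndicator

/-- The indicator function of `[0, 1)` as an element of `L²(ℝ)`. -/
noncomputable def unitIndicator : L2R :=
  indicatorConstLp 2 (measurableSet_Ico (a := (0 : ℝ)) (b := 1)) measure_Ico_lt_top.ne 1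

theorem fourier_indicator_Ico (ξ : ℝ) :
    𝓕 ((Set.Ico (0 : ℝ) 1).indicator fun _ => (1 : ℂ)) ξ =
      ∫ x in (0 : ℝ)..1, Complex.exp (-(2 * Real.pi * Complex.I * ξ) * x) := by
  rw [Real.fourier_real_eq, intervalIntegral.integral_of_le zero_le_one,
    ← integral_Ico_eq_integral_Ioc, ← integral_indicator measurableSet_Ico]
  congr 1 with x
  rw [← Set.indicator_smul_apply (Set.Ico (0 : ℝ) 1) (fun x => 𝐞 (-(x * ξ))) fun _ => (1 : ℂ)]
  congr 1 with x
  rw [Circle.smul_def, Real.fourierChar_apply, smul_eq_mul, mul_one]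
  congr 1
  push_cast
  ring

theorem fourier_indicator_Ico_ne_zero {ξ : ℝ} (hξ : ξ ∉ Set.range ((↑) : ℤ → ℝ)) :
    𝓕 ((Set.Ico (0 : ℝ) 1).indicator fun _ => (1 : ℂ)) ξ ≠ 0 := by
  have hξ0 : ξ ≠ 0 := fun h => hξ ⟨0, by rw [Int.cast_zero, h]⟩
  have hc : -(2 * Real.pi * Complex.I * ξ) ≠ 0 :=
    neg_ne_zero.mpr (mul_ne_zero Complex.two_pi_I_ne_zero (Complex.ofReal_ne_zero.mpr hξ0))
  rw [fourier_indicator_Ico, integral_exp_mul_complex hc]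
  refine div_ne_zero (fun h => ?_) hc
  simp only [Complex.ofReal_one, mul_one, Complex.ofReal_zero, mul_zero, Complex.exp_zero,
    sub_eq_zero, Complex.exp_eq_one_iff] at h
  obtain ⟨n, hn⟩ := h
  have heq : (ξ : ℂ) = ((-n : ℤ) : ℂ) := mul_left_cancel₀ Complex.two_pi_I_ne_zero
    (by push_cast; linear_combination -hn)
  exact hξ ⟨-n, by exact_mod_cast heq.symm⟩

theorem fourier_unitIndicator_ne_zero : ∀ᵐ ξ : ℝ, (𝓕 unitIndicator : L2R) ξ ≠ 0 := by
  have hint : Integrable ((Set.Ico (0 : ℝ) 1).indicator fun _ => (1 : ℂ)) :=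
    (integrable_indicator_iff measurableSet_Ico).mpr (by simp)
  filter_upwards [fourier_toLp_ae_eq hint
      (memLp_indicator_const 2 measurableSet_Ico (1 : ℂ) (.inr (by simp))),
    (Set.countable_range ((↑) : ℤ → ℝ)).ae_notMem volume] with ξ hξ hξ'
  exact hξ.trans_ne (fourier_indicator_Ico_ne_zero hξ')

theorem translateL2_unitIndicator (a : ℝ) :
    translateL2 unitIndicator a =
      indicatorConstLp 2 (measurableSet_Ico (a := a) (b := a + 1)) measure_Ico_lt_top.ne 1 := by
  rw [translateL2, unitIndicator, Lp.indicatorConstLp_compMeasurePreserving]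
  congr 1
  rw [Set.preimage_sub_const_Ico, zero_add, add_comm]

theorem orthonormal_translateL2_unitIndicator {ι : Type*} {a : ι → ℝ}
    (ha : Pairwise fun i j => 1 ≤ |a i - a j|) :
    Orthonormal ℂ fun i => translateL2 unitIndicator (a i) := by
  classical
  rw [orthonormal_iff_ite]
  intro i j
  rw [translateL2_unitIndicator, translateL2_unitIndicator,
    L2.inner_indicatorConstLp_one_indicatorConstLp_one _ _ measure_Ico_lt_top.ne
      measure_Ico_lt_top.ne]
  split_ifs with hij
  · subst hij
    simp
  · have hdisj : Set.Ico (a i) (a i + 1) ∩ Set.Ico (a j) (a j + 1) = ∅ := by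
      rw [← Set.disjoint_iff_inter_eq_empty, Set.Ico_disjoint_Ico]
      rcases le_abs.mp (ha hij) with h | h
      · exact (min_le_right _ _).trans (by linarith [le_max_left (a i) (a j)])
      · exact (min_le_left _ _).trans (by linarith [le_max_right (a i) (a j)])
    rw [hdisj, measureReal_empty, RCLike.ofReal_zero]

end UnitIndicator

section FourierMultiplier

/-- The Fourier multiplier operator on `L²(ℝ)` with symbol `m`. -/
noncomputable def fourierMultiplier (m : Lp ℂ ∞ (volume : Measure ℝ)) : L2R →L[ℂ] L2R :=
  (Lp.fourierTransformₗᵢ ℝ ℂ).symm.toContinuousLinearEquiv.toContinuousLinearMap ∘L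
    (ContinuousLinearMap.mul ℂ ℂ).holderL volume ∞ 2 2 m ∘L
      (Lp.fourierTransformₗᵢ ℝ ℂ).toContinuousLinearEquiv.toContinuousLinearMap

theorem fourier_fourierMultiplier (m : Lp ℂ ∞ (volume : Measure ℝ)) (f : L2R) :
    (𝓕 (fourierMultiplier m f) : L2R) =ᵐ[volume] fun ξ => m ξ * (𝓕 f : L2R) ξ := by
  have h : (𝓕 (fourierMultiplier m f) : L2R) =
      (ContinuousLinearMap.mul ℂ ℂ).holder 2 m (𝓕 f : L2R) :=
    (Lp.fourierTransformₗᵢ ℝ ℂ).apply_symm_apply _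
  rw [h]
  exact ContinuousLinearMap.coeFn_holder _ _ _

theorem translateL2_fourierMultiplier (m : Lp ℂ ∞ (volume : Measure ℝ)) (f : L2R) (a : ℝ) :
    translateL2 (fourierMultiplier m f) a = fourierMultiplier m (translateL2 f a) := by
  apply (Lp.fourierTransformₗᵢ ℝ ℂ).injective
  refine Lp.ext ((fourier_translateL2 _ a).trans ?_)
  filter_upwards [fourier_fourierMultiplier m f, fourier_fourierMultiplier m (translateL2 f a),
    fourier_translateL2 f a] with ξ hf hTf hT
  exact (show _ = _ by rw [hf, hT]; ring).trans hTf.symm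

theorem isBessel_translateL2_fourierMultiplier {ι : Type*} {a : ι → ℝ}
    (ha : Pairwise fun i j => 1 ≤ |a i - a j|) (m : Lp ℂ ∞ (volume : Measure ℝ)) :
    IsBessel fun i => translateL2 (fourierMultiplier m unitIndicator) (a i) := by
  simp only [translateL2_fourierMultiplier]
  exact isBessel_of_orthonormal (orthonormal_translateL2_unitIndicator ha) (fourierMultiplier m)

theorem norm_translateL2_sub_linearCombination_le {ι : Type*} {m : Lp ℂ ∞ (volume : Measure ℝ)}
    {a : ι → ℝ} {c : ι →₀ ℂ} {δ : ℝ} (h : ∀ᵐ ξ, ‖m ξ‖ * ‖expSum a c ξ - 1‖ ≤ δ) (f : L2R)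
    (r : ℝ) :
    ‖translateL2 (fourierMultiplier m f) r - Finsupp.linearCombination ℂ
      (fun j => translateL2 (fourierMultiplier m f) (r + a j)) c‖ ≤ δ * ‖f‖ := by
  set g := fourierMultiplier m f
  have hshift : ∀ ξ, expSum (fun j => r + a j) c ξ = (𝐞 (-(r * ξ)) : ℂ) * expSum a c ξ := by
    intro ξ
    rw [expSum, expSum, Finsupp.mul_sum]
    refine Finsupp.sum_congr fun j _ => ?_
    rw [add_mul, neg_add, AddChar.map_add_eq_mul, Circle.coe_mul]
    ring
  rw [← Lp.norm_fourier_eq, ← Lp.norm_fourier_eq f, sub_eq_add_neg,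
    FourierTransform.fourier_add, FourierTransform.fourier_neg, ← sub_eq_add_neg]
  refine Lp.norm_le_mul_norm_of_ae_le_mul ?_
  filter_upwards [h, Lp.coeFn_sub (𝓕 (translateL2 g r) : L2R) (𝓕 (Finsupp.linearCombination ℂ
      (fun j => translateL2 g (r + a j)) c) : L2R), fourier_translateL2 g r,
    fourier_linearCombination_translateL2 g (fun j => r + a j) c, fourier_fourierMultiplier m f]
    with ξ hδ hsub htrans hcomb hg
  have hfactor : (𝐞 (-(r * ξ)) : ℂ) * (m ξ * (𝓕 f : L2R) ξ) -
      (𝐞 (-(r * ξ)) : ℂ) * expSum a c ξ * (m ξ * (𝓕 f : L2R) ξ) =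
        -(𝐞 (-(r * ξ)) * (m ξ * (expSum a c ξ - 1) * (𝓕 f : L2R) ξ)) := by ring
  rw [hsub, Pi.sub_apply, htrans, hcomb, hshift, hg, hfactor, norm_neg, norm_mul, Circle.norm_coe,
    one_mul, norm_mul, norm_mul]
  gcongr

end FourierMultiplier

section Weight

variable {α : Type*} [MeasurableSpace α] {μ : Measure α}

theorem ae_eventually_norm_sub_one_le {η : ℕ → ℝ} {δ : ℕ → ℝ≥0∞} {f : ℕ → α → ℂ}
    (hδ : ∑' k, δ k ≠ ⊤) (hf : ∀ k, NearOneInMeasure μ (η k) (δ k) (f k)) :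
    ∀ᵐ x ∂μ, ∀ᶠ k in atTop, ‖f k x - 1‖ ≤ η k := by
  filter_upwards [ae_eventually_notMem (ne_top_of_le_ne_top hδ (ENNReal.tsum_le_tsum hf))] with x hx
  exact hx.mono fun k hk => not_lt.mp hk

theorem exists_weight_mul_le {f : ℕ → α → ℝ} {δ : ℕ → ℝ} (hfm : ∀ k, Measurable (f k))
    (hf0 : ∀ k x, 0 ≤ f k x) (hδ : ∀ k, 0 < δ k) (hf : ∀ᵐ x ∂μ, ∀ᶠ k in atTop, f k x ≤ δ k) :
    ∃ w : α → ℝ, Measurable w ∧ (∀ x, 0 < w x) ∧ (∀ x, w x ≤ 1) ∧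
      ∀ᵐ x ∂μ, ∀ k, w x * f k x ≤ δ k := by
  set S : α → ℝ := fun x => ⨆ k, f k x / δ k
  have hS0 : ∀ x, 0 ≤ S x := fun x => Real.iSup_nonneg fun k => div_nonneg (hf0 k x) (hδ k).le
  have hS1 : ∀ x, 0 < 1 + S x := fun x => by linarith [hS0 x]
  refine ⟨fun x => (1 + S x)⁻¹, ?_, fun x => inv_pos.mpr (hS1 x), fun x => ?_, ?_⟩
  · exact (measurable_const.add (Measurable.iSup fun k => (hfm k).div_const (δ k))).inv
  · exact inv_le_one_of_one_le₀ (by linarith [hS0 x])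
  filter_upwards [hf] with x hx k
  have hbdd : BddAbove (Set.range fun k => f k x / δ k) :=
    IsBoundedUnder.bddAbove_range
      ⟨1, eventually_map.mpr (hx.mono fun k hk => (div_le_one (hδ k)).mpr hk)⟩
  have hle : f k x / δ k ≤ 1 + S x := (le_ciSup hbdd k).trans (by linarith)
  rw [inv_mul_le_iff₀ (hS1 x)]
  exact (div_le_iff₀ (hδ k)).mp hle

theorem ae_coe_unitAddCircle {p : UnitAddCircle → Prop} (h : ∀ᵐ x, p x) :
    ∀ᵐ ξ : ℝ, p (ξ : UnitAddCircle) := by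
  rw [← Measure.restrict_univ (μ := (volume : Measure ℝ)), ← iUnion_Ioc_intCast ℝ,
    ae_restrict_iUnion_iff]
  exact fun n => (UnitAddCircle.measurePreserving_mk (n : ℝ)).quasiMeasurePreserving.ae h

theorem expSum_natCast_mul (D : ℕ) (c : ℕ →₀ ℂ) (ξ : ℝ) :
    expSum (fun j : ℕ => (D : ℝ) * j) c ξ =
      trigPoly (c.mapDomain Nat.cast) ((-(D : ℤ)) • (ξ : UnitAddCircle)) := by
  rw [trigPoly_apply, Finsupp.sum_mapDomain_index (by simp) (by simp [add_mul]), expSum]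
  refine Finsupp.sum_congr fun j _ => ?_
  rw [fourier_apply, smul_smul, ← fourier_apply, fourier_coe_apply, Real.fourierChar_apply]
  congr 2
  push_cast
  ring

theorem exists_symbol_norm_mul_le {δ : ℕ → ℝ} (hδ : ∀ k, 0 < δ k) (hsum : Summable δ)
    {c : ℕ → ℕ →₀ ℂ} (hc : ∀ k, NearOneInMeasure volume (δ k) (ENNReal.ofReal (δ k))
      (trigPoly ((c k).mapDomain Nat.cast))) {D : ℕ → ℕ} (hD : ∀ k, D k ≠ 0) :
    ∃ m : Lp ℂ ∞ (volume : Measure ℝ), (∀ᵐ ξ, m ξ ≠ 0) ∧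
      ∀ k, ∀ᵐ ξ, ‖m ξ‖ * ‖expSum (fun j : ℕ => (D k : ℝ) * j) (c k) ξ - 1‖ ≤ δ k := by
  set f : ℕ → ℝ → ℝ := fun k ξ => ‖expSum (fun j : ℕ => (D k : ℝ) * j) (c k) ξ - 1‖
  have hdilate : ∀ k, NearOneInMeasure volume (δ k) (ENNReal.ofReal (δ k))
      fun x => trigPoly ((c k).mapDomain Nat.cast) ((-(D k : ℤ)) • x) := fun k =>
    (hc k).comp_measurePreserving (by fun_prop)
      (Measure.measurePreserving_zsmul volume (by simpa using hD k))
  have hf : ∀ᵐ ξ : ℝ, ∀ᶠ k in atTop, f k ξ ≤ δ k := by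
    simp only [f, expSum_natCast_mul]
    exact ae_coe_unitAddCircle (ae_eventually_norm_sub_one_le
      hsum.tsum_ofReal_ne_top hdilate)
  have hfm : ∀ k, Measurable (f k) := fun k => by
    simp only [f, expSum_natCast_mul]
    exact Continuous.measurable (by fun_prop)
  obtain ⟨w, hwm, hw0, hw1, hw⟩ := exists_weight_mul_le hfm (fun _ _ => norm_nonneg _) hδ hf
  have hwnorm : ∀ ξ, ‖(w ξ : ℂ)‖ = w ξ := fun ξ => by
    rw [Complex.norm_real, Real.norm_of_nonneg (hw0 ξ).le]
  have hmem : MemLp (fun ξ => (w ξ : ℂ)) ∞ volume :=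
    memLp_top_of_bound (Complex.measurable_ofReal.comp hwm).aestronglyMeasurable 1
      (ae_of_all _ fun ξ => (hwnorm ξ).trans_le (hw1 ξ))
  refine ⟨hmem.toLp, ?_, fun k => ?_⟩
  · filter_upwards [hmem.coeFn_toLp] with ξ hξ
    exact hξ.trans_ne (Complex.ofReal_ne_zero.mpr (hw0 ξ).ne')
  · filter_upwards [hmem.coeFn_toLp, hw] with ξ hξ hwξ
    rw [hξ, hwnorm]
    exact hwξ k

end Weight

theorem exists_seq_dense_frequently_eq (X : Type*) [TopologicalSpace X]
    [TopologicalSpace.SeparableSpace X] [Nonempty X] :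
    ∃ ν : ℕ → X, Dense {x | ∃ᶠ k in atTop, ν k = x} := by
  refine ⟨fun k => TopologicalSpace.denseSeq X k.unpair.1,
    (TopologicalSpace.denseRange_denseSeq X).mono ?_⟩
  rintro _ ⟨i, rfl⟩
  refine frequently_atTop.mpr fun K => ⟨Nat.pair i K, Nat.right_le_pair i K, ?_⟩
  simp only [Nat.unpair_pair]

theorem completeWithLqEstimate_translateL2_fourierMultiplier {m : Lp ℂ ∞ (volume : Measure ℝ)}
    (hm : ∀ᵐ ξ, m ξ ≠ 0) {f : L2R} (hf : ∀ᵐ ξ, (𝓕 f : L2R) ξ ≠ 0) {p δ ν lam : ℕ → ℝ}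
    {s D : ℕ → ℕ} {c : ℕ → ℕ →₀ ℂ} (hp0 : ∀ k, 0 < p k) (hp : Tendsto p atTop (𝓝 2))
    (hδ : Tendsto δ atTop (𝓝 0)) (hν : Dense {x | ∃ᶠ k in atTop, ν k = x})
    (hc : ∀ k, lqNorm (p k) (c k) ≤ δ k)
    (hmc : ∀ k, ∀ᵐ ξ, ‖m ξ‖ * ‖expSum (fun j : ℕ => (D k : ℝ) * j) (c k) ξ - 1‖ ≤ δ k)
    (hlam : ∀ k, ∀ j ∈ (c k).support, lam (s k + j) = ν k + D k * j) {q : ℝ} (hq : 2 < q) :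
    CompleteWithLqEstimate q fun n => translateL2 (fourierMultiplier m f) (lam n) := by
  have hg : ∀ᵐ ξ, (𝓕 (fourierMultiplier m f) : L2R) ξ ≠ 0 := by
    filter_upwards [fourier_fourierMultiplier m f, hm, hf] with ξ hξ hmξ hfξ
    exact hξ.trans_ne (mul_ne_zero hmξ hfξ)
  refine completeWithLqEstimate_of_span_dense (by linarith : 1 ≤ q)
    (span_translates_dense hν hg) ?_
  rintro _ ⟨r, hr, rfl⟩ η hη
  have hδf : Tendsto (fun k => δ k * ‖f‖) atTop (𝓝 0) := by simpa using hδ.mul_const ‖f‖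
  obtain ⟨k, rfl, hδk, hδfk, hpk⟩ := (hr.and_eventually ((hδ.eventually_lt_const hη).and
    ((hδf.eventually_lt_const hη).and (hp.eventually_lt_const hq)))).exists
  refine ⟨(c k).mapDomain (s k + ·), ?_, ?_⟩
  · have hcomb : Finsupp.linearCombination ℂ
        (fun n => translateL2 (fourierMultiplier m f) (lam n)) ((c k).mapDomain (s k + ·)) =
        Finsupp.linearCombination ℂ
          (fun j : ℕ => translateL2 (fourierMultiplier m f) (ν k + D k * j)) (c k) := by
      rw [Finsupp.linearCombination_mapDomain]
      exact Finsupp.sum_congr fun j hj => by simp only [Function.comp_apply, hlam k j hj]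
    rw [hcomb]
    exact (norm_translateL2_sub_linearCombination_le (hmc k) f (ν k)).trans_lt hδfk
  · rw [lqNorm_mapDomain (add_right_injective (s k))]
    exact ((lqNorm_anti (hp0 k) hpk.le (c k)).trans (hc k)).trans_lt hδk

theorem theorem2 (ε : ℕ → ℝ) (hpos : ∀ n, 0 < ε n) (hlim : Tendsto ε atTop (𝓝 0)) :
    ∃ (lam : ℕ → ℝ) (g : L2R),
      (∀ n, 0 < lam n) ∧
      (∀ n, lam (n + 1) / lam n > 1 + ε n) ∧
      UniformlyDiscrete (Set.range lam) ∧
      IsQF (fun n => translateL2 g (lam n)) := by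
  set p : ℕ → ℝ := fun k => 2 + 1 / ((k : ℝ) + 1)
  have hp : ∀ k, 2 < p k := fun k => lt_add_of_pos_right 2 (by positivity)
  have hplim : Tendsto p atTop (𝓝 2) := by
    simpa [p] using tendsto_one_div_add_atTop_nhds_zero_nat.const_add (2 : ℝ)
  set δ : ℕ → ℝ := fun k => (1 / 2) ^ k
  have hδ : ∀ k, 0 < δ k := fun k => by positivity
  choose c hc0 hcq hc using fun k => exists_analytic_trigPoly_lqNorm_le_nearOne (hp k) (hδ k)
  obtain ⟨ν, hν⟩ := exists_seq_dense_frequently_eq ℝ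
  obtain ⟨lam, s, D, hD, hlam, hlam0, hratio, hsep⟩ :=
    exists_almost_lacunary_seq hlim (fun k => (c k).support.sup id) ν
  obtain ⟨m, hm, hmc⟩ := exists_symbol_norm_mul_le hδ summable_geometric_two hc hD
  have hlamc : ∀ k, ∀ j ∈ (c k).support, lam (s k + j) = ν k + D k * j := fun k j hj =>
    hlam k j (Finset.mem_Icc.mpr ⟨Nat.one_le_iff_ne_zero.mpr fun h =>
      Finsupp.mem_support_iff.mp hj (h ▸ hc0 k), Finset.le_sup (f := id) hj⟩)
  refine ⟨lam, fourierMultiplier m unitIndicator, hlam0,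
    fun n => (lt_div_iff₀ (hlam0 n)).mpr (hratio n), ⟨1, one_pos, ?_⟩, fun q hq => ?_,
    isBessel_translateL2_fourierMultiplier hsep m⟩
  · rintro _ ⟨i, rfl⟩ _ ⟨j, rfl⟩ hij
    exact hsep (ne_of_apply_ne lam hij)
  · exact completeWithLqEstimate_translateL2_fourierMultiplier hm fourier_unitIndicator_ne_zero
      (fun k => two_pos.trans (hp k)) hplim summable_geometric_two.tendsto_atTop_zero hν hcq hmc
      hlamc hq
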